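/- Let $\mathcal H$ be a complex Hilbert space, $\hbar>0$, and let $H$ be the (time-independent, in general unbounded) self-adjoint Hamiltonian of a closed quantum system with state space $\mathcal H$, with domain $D(H)$ and unitary evolution $U(t)=e^{-\frac{i}{\hbar}tH}$, $t\in\mathbb R$. A generalized state vector (ket) $|\psi\rangle$ is a bounded antilinear functional $\varphi\mapsto\langle\varphi|\psi\rangle$ on $D(H)$ with its graph norm (an element of $D(H)^*$ in the rigged triple $D(H)\subseteq\mathcal H\subseteq D(H)^*$); it evolves to $|\psi(t)\rangle=U(t)|\psi\rangle$, where $\langle\varphi|\psi(t)\rangle:=\langle U(-t)\varphi|\psi\rangle$. For $f\in C_c^\infty(\mathbb R,\mathbb C)$ a vector $v\in\mathcal H$ is written $\psi[f]=\int f(t)|\psi(t)\rangle\,dt$ if $\langle\varphi,v\rangle=\int f(t)\langle\varphi|\psi(t)\rangle\,dt$ for all $\varphi\in D(H)$. For an open set $J\subseteq\mathbb R$, $|\psi(s)\rangle$ is called orthogonal to the states $|\psi(t)\rangle$, $t\in J$, if the distribution $t\mapsto\langle\psi(s)|\psi(t)\rangle$ vanishes on $J$, that is, $\langle\psi[f]\,|\,\psi(s)\rangle=0$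 for every $f\in C_c^\infty(\mathbb R,\mathbb C)$ with support in $J$. Let $|\psi\rangle\neq0$ be a generalized state vector such that $|\psi(0)\rangle$ is orthogonal to all its past states ($t<0$), or to all its future states ($t>0$). Then: 1. For every $f\in C_c^\infty(\mathbb R,\mathbb C)$ the vector $\psi[f]$ exists and lies in $D(H)$, and states at distinct times are orthogonal: for every $s\in\mathbb R$, $|\psi(s)\rangle$ is orthogonal to the states $|\psi(t)\rangle$, $t\neq s$. 2. The Hilbert space $\mathcal V:=\overline{\mathrm{span}}\{\psi[f] : f\in C_c^\infty(\mathbb R,\mathbb C)\}$ spanned by the history is invariant under every $U(t)$, and $H$ maps $D(H)\cap\mathcal V$ into $\mathcal V$. 3. There is a unitary $W:\mathcal V\to L^2(\mathbb R,\mathbb C)$ such that (a) for some constant $c>0$, $W\psi[f]=c\,f$ for all $f\in C_c^\infty(\mathbb R,\mathbb C)$ (so $|\psi(t)\rangle$ corresponds to $c$ times the Dirac ket $|\tau=t\rangle$); (b) the evolution acts as translation: $(WU(t)x)(\tau)=(Wx)(\tau-t)$ for all $x\in\mathcal V$, $t\in\mathbb R$ and almost every $\tau$; (c) the restriction of $H$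 to $\mathcal V$ is $-i\hbar\,\frac{\partial}{\partial\tau}$: for $x,y\in\mathcal V$ one has $x\in D(H)$ and $Hx=y$ if and only if $Wx$ has a weak derivative $(Wx)'\in L^2(\mathbb R)$ and $Wy=-i\hbar\,(Wx)'$. In particular the domain of the restriction corresponds to the Sobolev space $H^1(\mathbb R)$. -/

import Mathlib

open MeasureTheory
open scoped ContDiff InnerProductSpace

noncomputable section

namespace QuantumHistory

/-- A strongly continuous one-parameter group of unitary operators on a Hilbert space. -/
structure UnitaryGroup (𝓗 : Type*) [NormedAddCommGroup 𝓗] [InnerProductSpace ℂ 𝓗] where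
  /-- the evolution operator from time `0` to time `t` -/
  op : ℝ → (𝓗 ≃ₗᵢ[ℂ] 𝓗)
  op_add : ∀ (s t : ℝ) (x : 𝓗), op (s + t) x = op s (op t x)
  continuous_op : ∀ x : 𝓗, Continuous fun t => op t x

variable {𝓗 : Type*} [NormedAddCommGroup 𝓗] [InnerProductSpace ℂ 𝓗]

/-- `H` is the Hamiltonian of the evolution `U`: a vector `x` lies in the domain of `H` exactly
when `t ↦ U(t) x` is differentiable at `0`, and then `iħ (d/dt) U(t) x = H x` at `t = 0`.
By Stone's theorem these are exactly the pairs of a self-adjoint `H` (in general unbounded)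
and `U(t) = exp(-itH/ħ)`. -/
def IsHamiltonian (ħ : ℝ) (H : 𝓗 →ₗ.[ℂ] 𝓗) (U : UnitaryGroup 𝓗) : Prop :=
  ∀ x y : 𝓗, (x, y) ∈ H.graph ↔
    HasDerivAt (fun t : ℝ => U.op t x) ((-Complex.I / (ħ : ℂ)) • y) 0

/-- The evolution commutes with its Hamiltonian. -/
theorem IsHamiltonian.mem_graph {ħ : ℝ} {H : 𝓗 →ₗ.[ℂ] 𝓗} {U : UnitaryGroup 𝓗}
    (hH : IsHamiltonian ħ H U) (s : ℝ) {x y : 𝓗} (h : (x, y) ∈ H.graph) :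
    (U.op s x, U.op s y) ∈ H.graph := by
  rw [hH] at h ⊢
  have h2 := ((U.op s).toContinuousLinearEquiv.toContinuousLinearMap.restrictScalars
    ℝ).hasFDerivAt.comp_hasDerivAt (0 : ℝ) h
  have e : (fun t : ℝ => U.op t (U.op s x)) = fun t : ℝ => U.op s (U.op t x) := by
    funext t
    rw [← U.op_add, ← U.op_add, add_comm]
  rw [e]
  simpa [Function.comp_def] using h2

theorem IsHamiltonian.op_mem {ħ : ℝ} {H : 𝓗 →ₗ.[ℂ] 𝓗} {U : UnitaryGroup 𝓗}
    (hH : IsHamiltonian ħ H U) (s : ℝ) (x : H.domain) : U.op s (x : 𝓗) ∈ H.domain :=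
  H.mem_domain_of_mem_graph (hH.mem_graph s (H.mem_graph x))

theorem IsHamiltonian.apply_op {ħ : ℝ} {H : 𝓗 →ₗ.[ℂ] 𝓗} {U : UnitaryGroup 𝓗}
    (hH : IsHamiltonian ħ H U) (s : ℝ) (x : H.domain) :
    H ⟨U.op s (x : 𝓗), hH.op_mem s x⟩ = U.op s (H x) :=
  H.mem_graph_snd_inj (H.mem_graph ⟨U.op s (x : 𝓗), hH.op_mem s x⟩)
    (hH.mem_graph s (H.mem_graph x)) rfl

/-- A generalized state vector (ket) `|ψ⟩` of the system with Hamiltonian `H`: a bounded antilinear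
functional `φ ↦ ⟨φ|ψ⟩` on the domain of `H` with its graph norm, i.e. an element of the last
space of the rigged triple `D(H) ⊆ 𝓗 ⊆ D(H)*`. A vector `x` of `𝓗` is the ket `φ ↦ ⟪φ, x⟫`; for
`H = -iħ d/dτ` on `L²(ℝ)` the Dirac kets `|τ⟩`, `φ ↦ conj (φ τ)`, are of this kind. -/
structure Ket (H : 𝓗 →ₗ.[ℂ] 𝓗) where
  /-- the antilinear functional `φ ↦ ⟨φ|ψ⟩` -/
  amp : H.domain →ₗ⋆[ℂ] ℂ
  bounded : ∃ C : ℝ, ∀ φ : H.domain, ‖amp φ‖ ≤ C * (‖(φ : 𝓗)‖ + ‖H φ‖)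

/-- The state `|ψ(t)⟩ = U(t)|ψ⟩`, that is `⟨φ|ψ(t)⟩ = ⟨U(-t)φ|ψ⟩`. -/
def Ket.evolve {ħ : ℝ} {H : 𝓗 →ₗ.[ℂ] 𝓗} {U : UnitaryGroup 𝓗}
    (hH : IsHamiltonian ħ H U) (ψ : Ket H) (t : ℝ) : Ket H where
  amp :=
    { toFun := fun φ => ψ.amp ⟨U.op (-t) (φ : 𝓗), hH.op_mem (-t) φ⟩
      map_add' := fun φ χ => by
        rw [← map_add]
        congr 1
        exact Subtype.ext (by simp)
      map_smul' := fun a φ => by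
        rw [← map_smulₛₗ]
        congr 1
        exact Subtype.ext (by simp) }
  bounded := by
    obtain ⟨C, hC⟩ := ψ.bounded
    refine ⟨C, fun φ => ?_⟩
    have h := hC ⟨U.op (-t) (φ : 𝓗), hH.op_mem (-t) φ⟩
    rw [hH.apply_op] at h
    simpa using h

/-- Test functions on the time line: smooth with compact support. -/
def IsTest (f : ℝ → ℂ) : Prop := ContDiff ℝ ∞ f ∧ HasCompactSupport f

/-- `v` is the superposition (wave packet) `∫ f(t) |ψ(t)⟩ dt` of the states in the history of
`ψ`: `⟪φ, v⟫ = ∫ f(t) ⟨φ|ψ(t)⟩ dt` for all `φ` in the domain of `H`. -/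
def IsPacket {ħ : ℝ} {H : 𝓗 →ₗ.[ℂ] 𝓗} {U : UnitaryGroup 𝓗}
    (hH : IsHamiltonian ħ H U) (ψ : Ket H) (f : ℝ → ℂ) (v : 𝓗) : Prop :=
  ∀ φ : H.domain, ⟪(φ : 𝓗), v⟫_ℂ = ∫ t : ℝ, f t * (ψ.evolve hH t).amp φ

/-- `|ψ(s)⟩` is orthogonal to `|ψ(t)⟩` for all `t` in the open set `J`: the distribution
`t ↦ ⟨ψ(s)|ψ(t)⟩` vanishes on `J`, i.e. `|ψ(s)⟩` is orthogonal to every superposition of the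
states `|ψ(t)⟩`, `t ∈ J`. For `ψ` in `𝓗` this says `⟪ψ(s), ψ(t)⟫ = 0` for all `t ∈ J`. -/
def IsOrthogonalOn {ħ : ℝ} {H : 𝓗 →ₗ.[ℂ] 𝓗} {U : UnitaryGroup 𝓗}
    (hH : IsHamiltonian ħ H U) (ψ : Ket H) (s : ℝ) (J : Set ℝ) : Prop :=
  ∀ f : ℝ → ℂ, IsTest f → tsupport f ⊆ J →
    ∀ v : H.domain, IsPacket hH ψ f (v : 𝓗) → (ψ.evolve hH s).amp v = 0

/-- The Hilbert space spanned by the states in the history of `ψ`: the closed linear span of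
their superpositions. -/
def historySpan {ħ : ℝ} {H : 𝓗 →ₗ.[ℂ] 𝓗} {U : UnitaryGroup 𝓗}
    (hH : IsHamiltonian ħ H U) (ψ : Ket H) : Submodule ℂ 𝓗 :=
  (Submodule.span ℂ {v : 𝓗 | ∃ f : ℝ → ℂ, IsTest f ∧ IsPacket hH ψ f v}).topologicalClosure

/-- `g' ∈ L²(ℝ)` is the weak derivative of `g ∈ L²(ℝ)`. -/
def HasWeakDeriv (g g' : Lp ℂ 2 (volume : Measure ℝ)) : Prop :=
  ∀ φ : ℝ → ℂ, IsTest φ → ∫ τ : ℝ, deriv φ τ * g τ = -∫ τ : ℝ, φ τ * g' τ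

end QuantumHistory

end

/-! Represent the ket by a vector `χ` of `D(H)` with its graph inner product, `ψ = (1 + H²) χ`.
The packet with profile `f` is then `∫ (f - ħ² f'')(t) U(t) χ dt`, and one-sided orthogonality says
that the autocorrelation `K(t) = ⟨χ|ψ(t)⟩` solves `K - ħ² K'' = 0` on a half-line. Since `K` is
bounded and `K(-t)` is the conjugate of `K(t)`, it follows that `K(t) = K(0) exp(-|t|/ħ)` on the
whole line. This is a multiple of the fundamental solution of `1 - ħ² d²/dt²`, whence
`⟨ψ(s)|ψ(t)⟩ = c² δ(s - t)`. So packets depend isometrically, up to the factor `c`, on their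
profiles in `L²(ℝ)`, the evolution translates profiles, and the generator of translations is the
weak derivative. -/

noncomputable section

namespace QuantumHistory

/-! ### Test functions -/

namespace IsTest

variable {f g : ℝ → ℂ}

theorem continuous (hf : IsTest f) : Continuous f := hf.1.continuous

theorem differentiable (hf : IsTest f) : Differentiable ℝ f := hf.1.differentiable (by simp)

theorem contDiff_one (hf : IsTest f) : ContDiff ℝ 1 f := hf.1.of_le (by exact_mod_cast le_top)

theorem deriv (hf : IsTest f) : IsTest (deriv f) :=
  ⟨(contDiff_infty_iff_deriv.1 hf.1).2, hf.2.deriv⟩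

theorem add (hf : IsTest f) (hg : IsTest g) : IsTest (f + g) := ⟨hf.1.add hg.1, hf.2.add hg.2⟩

theorem const_smul (c : ℂ) (hf : IsTest f) : IsTest (c • f) :=
  ⟨contDiff_const.smul hf.1, hf.2.smul_left (f := fun _ => c)⟩

theorem comp_neg (hf : IsTest f) : IsTest fun t => f (-t) :=
  ⟨hf.1.comp contDiff_neg, hf.2.comp_homeomorph (Homeomorph.neg ℝ)⟩

theorem comp_sub_right (hf : IsTest f) (s : ℝ) : IsTest fun t => f (t - s) :=
  ⟨hf.1.comp (contDiff_id.sub contDiff_const), hf.2.comp_homeomorph (Homeomorph.subRight s)⟩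

theorem conj (hf : IsTest f) : IsTest fun t => starRingEnd ℂ (f t) :=
  ⟨Complex.conjCLE.contDiff.comp hf.1, hf.2.comp_left (map_zero _)⟩

theorem ofReal {f : ℝ → ℝ} (hf : ContDiff ℝ ∞ f) (hc : HasCompactSupport f) :
    IsTest fun t => (f t : ℂ) :=
  ⟨Complex.ofRealCLM.contDiff.comp hf, hc.comp_left Complex.ofReal_zero⟩

theorem integrable (hf : IsTest f) : Integrable f :=
  hf.continuous.integrable_of_hasCompactSupport hf.2

section

variable {E : Type*} [NormedAddCommGroup E] [NormedSpace ℂ E]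

theorem integrable_smul (hf : IsTest f) {k : ℝ → E} (hk : Continuous k) :
    Integrable fun t => f t • k t :=
  (hf.continuous.smul hk).integrable_of_hasCompactSupport hf.2.smul_right

theorem hasDerivAt_integral_comp_sub_smul [CompleteSpace E] (hf : IsTest f) {k : ℝ → E}
    (hk : LocallyIntegrable k) (t : ℝ) :
    HasDerivAt (fun t => ∫ s, f (s - t) • k s) (-∫ s, _root_.deriv f (s - t) • k s) t := by
  have h := hf.comp_neg.2.hasDerivAt_convolution_right
    (ContinuousLinearMap.lsmul ℝ ℂ : ℂ →L[ℝ] E →L[ℝ] E).flip hk hf.comp_neg.contDiff_one t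
  convert h using 1
  · ext t
    simp [MeasureTheory.convolution]
  · simp [MeasureTheory.convolution, deriv_comp_neg, integral_neg]

end

end IsTest

theorem eqOn_zero_of_integral_test_mul_eq_zero {k : ℝ → ℂ} (hk : Continuous k) {J : Set ℝ}
    (hJ : IsOpen J) (h : ∀ f : ℝ → ℂ, IsTest f → tsupport f ⊆ J → ∫ t, f t * k t = 0) :
    Set.EqOn k 0 J := by
  have h_ae : ∀ᵐ t, t ∈ J → k t = 0 := by
    refine hJ.ae_eq_zero_of_integral_contDiff_smul_eq_zero
      (hk.locallyIntegrable.locallyIntegrableOn J) fun g hg hgc hgs => ?_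
    simpa only [Complex.real_smul] using h _ (IsTest.ofReal hg hgc)
      ((tsupport_comp_subset (g := Complex.ofReal) Complex.ofReal_zero g).trans hgs)
  exact Measure.eqOn_open_of_ae_eq (μ := volume) ((ae_restrict_iff' hJ.measurableSet).2 h_ae) hJ
    hk.continuousOn continuousOn_const

theorem hasDerivAt_of_forall_inner {E : Type*} [NormedAddCommGroup E] [InnerProductSpace ℂ E]
    [CompleteSpace E] {D : Set E} (hD : Dense D) {F G : ℝ → E} (hG : Continuous G)
    (h : ∀ v ∈ D, ∀ s, HasDerivAt (fun s => ⟪v, F s⟫_ℂ) ⟪v, G s⟫_ℂ s) (t : ℝ) :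
    HasDerivAt F (G t) t := by
  have h_int : ∀ s, HasDerivAt (fun s => ∫ r in (0 : ℝ)..s, G r) (G s) s := fun s =>
    (hG.integral_hasStrictDerivAt 0 s).hasDerivAt
  have h_eq : ∀ s, F s = F 0 + ∫ r in (0 : ℝ)..s, G r := fun s => by
    refine hD.eq_of_inner_right ℂ fun v hv => ?_
    have h_const : ∀ s, HasDerivAt (fun s => ⟪v, F s⟫_ℂ - ⟪v, ∫ r in (0 : ℝ)..s, G r⟫_ℂ) 0 s :=
      fun s => by
        simpa using (h v hv s).fun_sub ((hasDerivAt_const s v).inner ℂ (h_int s))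
    have := is_const_of_deriv_eq_zero (fun s => (h_const s).differentiableAt)
      (fun s => (h_const s).deriv) s 0
    simp only [intervalIntegral.integral_same, inner_zero_right, sub_zero] at this
    rw [inner_add_right, ← this, sub_add_cancel]
  rw [funext h_eq]
  exact (h_int t).const_add (F 0)

/-! ### The operator `1 - a² d²/dt²` -/

/-- The differential operator `1 - a² d²/dt²`. With `a = ħ` it is the action of `1 + H²` on the
profiles of wave packets. -/
def helmholtz (a : ℝ) (f : ℝ → ℂ) (t : ℝ) : ℂ := f t - a ^ 2 * deriv (deriv f) t

theorem IsTest.helmholtz {f : ℝ → ℂ} (hf : IsTest f) (a : ℝ) : IsTest (helmholtz a f) := by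
  convert hf.add (hf.deriv.deriv.const_smul (-(a : ℂ) ^ 2)) using 1
  ext t
  simp [QuantumHistory.helmholtz, sub_eq_add_neg]

section Helmholtz

variable {a : ℝ} {f g : ℝ → ℂ}

theorem helmholtz_add (a : ℝ) (hf : IsTest f) (hg : IsTest g) :
    helmholtz a (f + g) = helmholtz a f + helmholtz a g := by
  have h_deriv : deriv (f + g) = deriv f + deriv g :=
    funext fun t => deriv_add (hf.differentiable t) (hg.differentiable t)
  ext t
  simp only [helmholtz, h_deriv, Pi.add_apply,
    deriv_add (hf.deriv.differentiable t) (hg.deriv.differentiable t)]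
  ring

theorem helmholtz_const_smul (a : ℝ) (c : ℂ) (f : ℝ → ℂ) :
    helmholtz a (c • f) = c • helmholtz a f := by
  have h_deriv : ∀ f : ℝ → ℂ, deriv (c • f) = c • deriv f :=
    fun f => funext fun t => deriv_const_smul_field c f
  ext t
  simp only [helmholtz, h_deriv, Pi.smul_apply, smul_eq_mul]
  ring

theorem helmholtz_comp_sub_right (a : ℝ) (f : ℝ → ℂ) (s : ℝ) :
    helmholtz a (fun t => f (t - s)) = fun t => helmholtz a f (t - s) := by
  ext t
  simp only [helmholtz, funext fun t => deriv_comp_sub_const f s t, deriv_comp_sub_const]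

theorem helmholtz_comp_neg (a : ℝ) (f : ℝ → ℂ) :
    helmholtz a (fun t => f (-t)) = fun t => helmholtz a f (-t) := by
  ext t
  simp [helmholtz, funext fun t => deriv_comp_neg f t, deriv_comp_neg]

theorem integral_Ioi_helmholtz_mul_exp (ha : a ≠ 0) (hf : IsTest f) :
    ∫ t in Set.Ioi 0, helmholtz a f t * Real.exp (-t / a) = a ^ 2 * deriv f 0 + a * f 0 := by
  set e : ℝ → ℂ := fun t => Real.exp (-t / a) with he
  have he_deriv : ∀ t, HasDerivAt e (-e t / a) t := fun t => by
    refine (((hasDerivAt_neg t).div_const a).exp).ofReal_comp.congr_deriv ?_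
    simp only [he]
    push_cast
    ring
  set G : ℝ → ℂ := fun t => e t * (a ^ 2 * deriv f t + a * f t) with hG
  have hG_deriv : ∀ t, deriv G t = -(helmholtz a f t * e t) := fun t => by
    have h_sum := ((hf.deriv.differentiable t).hasDerivAt.const_mul ((a : ℂ) ^ 2)).fun_add
      ((hf.differentiable t).hasDerivAt.const_mul (a : ℂ))
    rw [((he_deriv t).fun_mul h_sum).deriv, helmholtz]
    have : (a : ℂ) ≠ 0 := Complex.ofReal_ne_zero.2 ha
    field_simp
    ring
  have hG_supp : HasCompactSupport G :=
    ((hf.2.deriv.mul_left (f := fun _ => (a : ℂ) ^ 2)).add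
      (hf.2.mul_left (f := fun _ => (a : ℂ)))).mul_left
  have hG_contDiff : ContDiff ℝ 1 G := by
    refine ContDiff.mul ?_ ((contDiff_const.mul hf.deriv.contDiff_one).add
      (contDiff_const.mul hf.contDiff_one))
    exact Complex.ofRealCLM.contDiff.comp
      (Real.contDiff_exp.comp (contDiff_id.neg.div_const a))
  have h := hG_supp.integral_Ioi_deriv_eq hG_contDiff 0
  simp only [hG_deriv, integral_neg, neg_inj] at h
  simpa [hG, he] using h

/-- `exp (-|t| / a) / (2 a)` is a Green function of `1 - a² d²/dt²`. -/
theorem integral_helmholtz_mul_exp_neg_abs (ha : a ≠ 0) (hf : IsTest f) :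
    ∫ t, helmholtz a f t * Real.exp (-|t| / a) = 2 * a * f 0 := by
  have h_int : Integrable fun t => helmholtz a f t * Real.exp (-|t| / a) :=
    (hf.helmholtz a).integrable_smul (by fun_prop)
  have h_pos : ∫ t in Set.Ioi 0, helmholtz a f t * Real.exp (-|t| / a) =
      a ^ 2 * deriv f 0 + a * f 0 := by
    rw [← integral_Ioi_helmholtz_mul_exp ha hf]
    refine setIntegral_congr_fun measurableSet_Ioi fun t ht => ?_
    simp only [abs_of_pos ht.out]
  have h_neg : ∫ t in Set.Iic 0, helmholtz a f t * Real.exp (-|t| / a) =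
      -a ^ 2 * deriv f 0 + a * f 0 := by
    have h_refl := integral_Ioi_helmholtz_mul_exp ha hf.comp_neg
    simp only [helmholtz_comp_neg, deriv_comp_neg, neg_zero] at h_refl
    rw [neg_mul_comm, ← h_refl, ← neg_zero, ← integral_comp_neg_Ioi, neg_zero]
    refine setIntegral_congr_fun measurableSet_Ioi fun t ht => ?_
    simp only [abs_neg, abs_of_pos ht.out]
  rw [← intervalIntegral.integral_Iic_add_Ioi h_int.integrableOn h_int.integrableOn, h_pos, h_neg]
  ring

theorem eq_of_hasDerivAt_zero_of_nonneg {E : Type*} [NormedAddCommGroup E] [NormedSpace ℝ E]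
    {f : ℝ → E} (h : ∀ t, 0 ≤ t → HasDerivAt f 0 t) {t : ℝ} (ht : 0 ≤ t) : f t = f 0 :=
  constant_of_has_deriv_right_zero (fun s hs => (h s hs.1).continuousAt.continuousWithinAt)
    (fun s hs => (h s hs.1).hasDerivWithinAt) t ⟨ht, le_rfl⟩

/-- The growing mode `exp (t / a)` of `a² k'' = k` is excluded by boundedness. -/
theorem eq_exp_smul_of_bounded {E : Type*} [NormedAddCommGroup E] [NormedSpace ℝ E] (ha : 0 < a)
    {k k' : ℝ → E} {C : ℝ} (hk : ∀ t, 0 ≤ t → HasDerivAt k (k' t) t)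
    (hk' : ∀ t, 0 ≤ t → HasDerivAt k' ((a ^ 2)⁻¹ • k t) t)
    (hC : ∀ t, 0 ≤ t → ‖k t + a • k' t‖ ≤ C) {t : ℝ} (ht : 0 ≤ t) :
    k t = Real.exp (-t / a) • k 0 := by
  have h_exp : ∀ b s : ℝ, HasDerivAt (fun s => Real.exp (b * s)) (b * Real.exp (b * s)) s :=
    fun b s => by simpa [mul_comm] using ((hasDerivAt_id s).const_mul b).exp
  have h_const : ∀ s, 0 ≤ s → Real.exp (-a⁻¹ * s) • (k s + a • k' s) = k 0 + a • k' 0 :=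
    fun s hs => by
      have := eq_of_hasDerivAt_zero_of_nonneg (fun s hs => ?_) hs
        (f := fun s => Real.exp (-a⁻¹ * s) • (k s + a • k' s))
      · simpa using this
      · convert (h_exp (-a⁻¹) s).fun_smul ((hk s hs).fun_add ((hk' s hs).fun_const_smul a)) using 1
        match_scalars <;> field_simp <;> ring
  have h_decaying : k 0 + a • k' 0 = 0 := by
    have h_lim : Filter.Tendsto (fun s : ℝ => Real.exp (-a⁻¹ * s) * C) Filter.atTop (nhds 0) := by
      rw [← zero_mul C]
      refine (Real.tendsto_exp_atBot.comp ?_).mul_const C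
      exact Filter.tendsto_id.const_mul_atTop_of_neg (by simpa using ha)
    refine norm_le_zero_iff.1 (ge_of_tendsto h_lim ?_)
    filter_upwards [Filter.eventually_ge_atTop 0] with s hs
    rw [← h_const s hs, norm_smul, Real.norm_of_nonneg (Real.exp_nonneg _)]
    exact mul_le_mul_of_nonneg_left (hC s hs) (Real.exp_nonneg _)
  have h_first : ∀ s, 0 ≤ s → k s + a • k' s = 0 := fun s hs =>
    (smul_eq_zero.1 ((h_const s hs).trans h_decaying)).resolve_left (Real.exp_ne_zero _)
  have h_exp_smul : Real.exp (a⁻¹ * t) • k t = k 0 := by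
    have := eq_of_hasDerivAt_zero_of_nonneg (fun s hs => ?_) ht
      (f := fun s => Real.exp (a⁻¹ * s) • k s)
    · simpa using this
    · convert (h_exp a⁻¹ s).fun_smul (hk s hs) using 1
      rw [← smul_zero (a⁻¹ * Real.exp (a⁻¹ * s)), ← h_first s hs]
      match_scalars <;> field_simp
  rw [← h_exp_smul, smul_smul, ← Real.exp_add]
  simp [div_eq_inv_mul]

theorem integral_comp_sub_mul_eq_exp_mul (ha : 0 < a) {K : ℝ → ℂ} (hK : Continuous K) {C : ℝ}
    (hC : ∀ t, ‖K t‖ ≤ C)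
    (h : ∀ f, IsTest f → tsupport f ⊆ Set.Ioi 0 → ∫ t, helmholtz a f t * K t = 0)
    (hf : IsTest f) (hfs : tsupport f ⊆ Set.Ioi 0) {t : ℝ} (ht : 0 ≤ t) :
    ∫ s, f (s - t) * K s = Real.exp (-t / a) * ∫ s, f s * K s := by
  set k : (ℝ → ℂ) → ℝ → ℂ := fun f t => ∫ s, f (s - t) * K s with hk
  have hk_deriv : ∀ f, IsTest f → ∀ t, HasDerivAt (k f) (-k (deriv f) t) t := fun f hf t =>
    hf.hasDerivAt_integral_comp_sub_smul hK.locallyIntegrable t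
  have hk_bound : ∀ f, IsTest f → ∀ t, ‖k f t‖ ≤ (∫ s, ‖f s‖) * C := fun f hf t => by
    rw [← integral_sub_right_eq_self (fun s => ‖f s‖) t, ← integral_mul_const]
    refine norm_integral_le_of_norm_le ((hf.comp_sub_right t).integrable.norm.mul_const C) ?_
    filter_upwards with s
    rw [norm_mul]
    exact mul_le_mul_of_nonneg_left (hC s) (norm_nonneg _)
  have hk_ode : ∀ t, 0 ≤ t → k f t = a ^ 2 * k (deriv (deriv f)) t := fun t ht => by
    have h_supp : tsupport (fun s => f (s - t)) ⊆ Set.Ioi 0 := fun s hs =>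
      ht.trans_lt <| sub_pos.1 <| hfs <|
        tsupport_comp_subset_preimage f (continuous_id.sub continuous_const) hs
    have h_zero := h _ (hf.comp_sub_right t) h_supp
    have h_int := (hf.comp_sub_right t).integrable_smul hK
    have h_int'' := (hf.deriv.deriv.comp_sub_right t).integrable_smul hK
    simp only [smul_eq_mul] at h_int h_int''
    rw [helmholtz_comp_sub_right] at h_zero
    simp only [helmholtz, sub_mul, mul_assoc] at h_zero
    rwa [integral_sub h_int (h_int''.const_mul _), integral_const_mul, sub_eq_zero] at h_zero
  have hk_deriv_deriv : ∀ t, 0 ≤ t →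
      HasDerivAt (fun t => -k (deriv f) t) ((a ^ 2)⁻¹ • k f t) t := fun t ht => by
    refine (hk_deriv _ hf.deriv t).fun_neg.congr_deriv ?_
    rw [hk_ode t ht, neg_neg, Complex.real_smul]
    have : (a : ℂ) ≠ 0 := Complex.ofReal_ne_zero.2 ha.ne'
    push_cast
    field_simp
  have h_eq := eq_exp_smul_of_bounded ha (fun t _ => hk_deriv f hf t) hk_deriv_deriv
    (fun t _ => norm_add_le_of_le (hk_bound f hf t)
      ((norm_smul_le _ _).trans (mul_le_mul_of_nonneg_left
        ((norm_neg _).trans_le (hk_bound _ hf.deriv t)) (norm_nonneg a)))) ht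
  simpa only [hk, sub_zero, Complex.real_smul] using h_eq

theorem eq_exp_mul_of_integral_helmholtz_mul_eq_zero (ha : 0 < a) {K : ℝ → ℂ}
    (hK : Continuous K) {C : ℝ} (hC : ∀ t, ‖K t‖ ≤ C)
    (h : ∀ f, IsTest f → tsupport f ⊆ Set.Ioi 0 → ∫ t, helmholtz a f t * K t = 0) {t : ℝ}
    (ht : 0 ≤ t) : K t = Real.exp (-t / a) * K 0 := by
  have hK_shift : Continuous fun s => K (s + t) := by fun_prop
  have h_Ioi := eqOn_zero_of_integral_test_mul_eq_zero
    (k := fun s => K (s + t) - Real.exp (-t / a) * K s) (by fun_prop) isOpen_Ioi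
    fun f hf hfs => by
      have h_int : Integrable fun s => f s * K s := hf.integrable_smul hK
      have h_int_shift : Integrable fun s => f s * K (s + t) := hf.integrable_smul hK_shift
      have h_eq := integral_comp_sub_mul_eq_exp_mul ha hK hC h hf hfs ht
      rw [← integral_add_right_eq_self _ t, ← integral_const_mul] at h_eq
      simp only [add_sub_cancel_right] at h_eq
      simp only [mul_sub, mul_left_comm (f _)]
      rw [integral_sub h_int_shift (h_int.const_mul _), h_eq, sub_self]
  have h_Ici := h_Ioi.closure (by fun_prop) continuous_const
  rw [closure_Ioi] at h_Ici
  simpa [sub_eq_zero] using h_Ici Set.self_mem_Ici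

theorem eq_exp_neg_abs_mul_of_integral_helmholtz_mul_eq_zero (ha : 0 < a) {K : ℝ → ℂ}
    (hK : Continuous K) {C : ℝ} (hC : ∀ t, ‖K t‖ ≤ C) (hK_neg : ∀ t, K (-t) = starRingEnd ℂ (K t))
    {J : Set ℝ} (hJ : J = Set.Iio 0 ∨ J = Set.Ioi 0)
    (h : ∀ f, IsTest f → tsupport f ⊆ J → ∫ t, helmholtz a f t * K t = 0) (t : ℝ) :
    K t = Real.exp (-|t| / a) * K 0 := by
  have hK_zero : starRingEnd ℂ (K 0) = K 0 := by rw [← hK_neg, neg_zero]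
  have h_nonneg : ∀ t, 0 ≤ t → K t = Real.exp (-t / a) * K 0 := by
    rcases hJ with rfl | rfl
    · intro t ht
      have h_refl : ∀ f, IsTest f → tsupport f ⊆ Set.Ioi 0 →
          ∫ t, helmholtz a f t * K (-t) = 0 := fun f hf hfs => by
        rw [← integral_neg_eq_self]
        have h_zero := h _ hf.comp_neg fun s hs =>
          Set.mem_Iio.2 <| Left.neg_pos_iff.1 <| hfs <|
            tsupport_comp_subset_preimage f continuous_neg hs
        simpa only [neg_neg, helmholtz_comp_neg] using h_zero
      have h_exp := eq_exp_mul_of_integral_helmholtz_mul_eq_zero ha (K := fun t => K (-t))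
        (hK.comp continuous_neg) (fun t => hC (-t)) h_refl ht
      simpa only [hK_neg, hK_zero, map_mul, Complex.conj_conj, neg_zero, Complex.conj_ofReal] using
        congrArg (starRingEnd ℂ) h_exp
    · exact fun t ht => eq_exp_mul_of_integral_helmholtz_mul_eq_zero ha hK hC h ht
  rcases le_total 0 t with ht | ht
  · rw [abs_of_nonneg ht, h_nonneg t ht]
  · have h_neg := h_nonneg (-t) (neg_nonneg.2 ht)
    rw [hK_neg] at h_neg
    rw [abs_of_nonpos ht, ← Complex.conj_conj (K t), h_neg, map_mul, Complex.conj_ofReal, hK_zero]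

end Helmholtz

variable {𝓗 : Type*} [NormedAddCommGroup 𝓗] [InnerProductSpace ℂ 𝓗]

/-! ### Smeared vectors -/

namespace UnitaryGroup

variable (U : UnitaryGroup 𝓗)

theorem op_zero (x : 𝓗) : U.op 0 x = x :=
  (U.op 0).injective (by rw [← U.op_add, add_zero])

theorem op_neg_op (t : ℝ) (x : 𝓗) : U.op (-t) (U.op t x) = x := by
  rw [← U.op_add, neg_add_cancel, U.op_zero]

theorem inner_op_neg_left (t : ℝ) (x y : 𝓗) : ⟪U.op (-t) x, y⟫_ℂ = ⟪x, U.op t y⟫_ℂ := by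
  rw [← (U.op (-t)).inner_map_map x, U.op_neg_op]

/-- The vector `∫ f(t) U(t) x dt`, in the domain of the Hamiltonian if `f` is a test function. -/
def smear (f : ℝ → ℂ) (x : 𝓗) : 𝓗 := ∫ t, f t • U.op t x

variable {U} {f g : ℝ → ℂ}

theorem integrable_smul_op (hf : IsTest f) (x : 𝓗) : Integrable fun t => f t • U.op t x :=
  hf.integrable_smul (U.continuous_op x)

theorem smear_add (hf : IsTest f) (hg : IsTest g) (x : 𝓗) :
    U.smear (f + g) x = U.smear f x + U.smear g x := by
  simp only [smear, Pi.add_apply, add_smul]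
  exact integral_add (integrable_smul_op hf x) (integrable_smul_op hg x)

theorem smear_const_smul (c : ℂ) (f : ℝ → ℂ) (x : 𝓗) : U.smear (c • f) x = c • U.smear f x := by
  simp only [smear, Pi.smul_apply, smul_assoc, integral_smul]

theorem op_smear (s : ℝ) (f : ℝ → ℂ) (x : 𝓗) :
    U.op s (U.smear f x) = U.smear (fun t => f (t - s)) x := by
  calc U.op s (U.smear f x) = ∫ t, U.op s (f t • U.op t x) :=
        ((U.op s).toContinuousLinearEquiv.integral_comp_comm _).symm
    _ = ∫ t, f (t + s - s) • U.op (t + s) x := by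
        simp only [map_smul, ← U.op_add, add_comm _ s, add_sub_cancel_left]
    _ = U.smear (fun t => f (t - s)) x :=
        integral_add_right_eq_self (fun t => f (t - s) • U.op t x) s

variable [CompleteSpace 𝓗]

theorem inner_smear (hf : IsTest f) (x y : 𝓗) :
    ⟪y, U.smear f x⟫_ℂ = ∫ t, f t * ⟪y, U.op t x⟫_ℂ := by
  simp only [smear, ← integral_inner (integrable_smul_op hf x), inner_smul_right]

theorem hasDerivAt_op_smear (hf : IsTest f) (x : 𝓗) (t : ℝ) :
    HasDerivAt (fun s => U.op s (U.smear f x)) (-U.op t (U.smear (deriv f) x)) t := by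
  simp only [op_smear]
  exact hf.hasDerivAt_integral_comp_sub_smul (U.continuous_op x).locallyIntegrable t

end UnitaryGroup

open UnitaryGroup

/-! ### The Hamiltonian -/

namespace IsHamiltonian

variable {ħ : ℝ} {H : 𝓗 →ₗ.[ℂ] 𝓗} {U : UnitaryGroup 𝓗} {f : ℝ → ℂ} {x x' y y' : 𝓗}

theorem hasDerivAt_op (hH : IsHamiltonian ħ H U) (h : (x, y) ∈ H.graph) (t : ℝ) :
    HasDerivAt (fun t => U.op t x) ((-Complex.I / ħ) • U.op t y) t := by
  have h_shift : HasDerivAt (fun s => U.op (s - t) (U.op t x)) ((-Complex.I / ħ) • U.op t y) t := by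
    refine HasDerivAt.comp_sub_const t t (f := fun s => U.op s (U.op t x)) ?_
    rw [sub_self]
    exact (hH _ _).1 (hH.mem_graph t h)
  simpa only [← U.op_add, sub_add_cancel] using h_shift

theorem inner_symm (hH : IsHamiltonian ħ H U) (hħ : ħ ≠ 0) (h : (x, y) ∈ H.graph)
    (h' : (x', y') ∈ H.graph) : ⟪y, x'⟫_ℂ = ⟪x, y'⟫_ℂ := by
  have h_deriv := (hH.hasDerivAt_op h 0).inner ℂ (hH.hasDerivAt_op h' 0)
  simp only [LinearIsometryEquiv.inner_map_map, U.op_zero] at h_deriv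
  have h_zero := h_deriv.unique (hasDerivAt_const _ _)
  simp only [inner_smul_left, inner_smul_right, map_div₀, map_neg, Complex.conj_I,
    Complex.conj_ofReal] at h_zero
  have h_ne : Complex.I / ħ ≠ 0 := div_ne_zero Complex.I_ne_zero (Complex.ofReal_ne_zero.2 hħ)
  exact mul_left_cancel₀ h_ne (by linear_combination h_zero)

theorem mem_of_forall_op_mem (hH : IsHamiltonian ħ H U) (hħ : ħ ≠ 0) {V : Submodule ℂ 𝓗}
    (hV : IsClosed (V : Set 𝓗)) (hUV : ∀ t, ∀ x ∈ V, U.op t x ∈ V) (h : (x, y) ∈ H.graph)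
    (hx : x ∈ V) : y ∈ V := by
  have h_deriv : (-Complex.I / ħ) • y ∈ V := by
    refine hV.mem_of_tendsto (hasDerivAt_iff_tendsto_slope_zero.1 ((hH x y).1 h))
      (Filter.Eventually.of_forall fun t => ?_)
    exact (V.restrictScalars ℝ).smul_mem _ (V.sub_mem (hUV _ _ hx) (hUV _ _ hx))
  exact (V.smul_mem_iff (by simpa using hħ)).1 h_deriv

theorem smear_of_mem_graph (hH : IsHamiltonian ħ H U) (hħ : ħ ≠ 0) (hf : IsTest f)
    (h : (x, y) ∈ H.graph) : U.smear f y = (-Complex.I * ħ) • U.smear (deriv f) x := by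
  have h_parts : ∫ t, f t • (-Complex.I / (ħ : ℂ)) • U.op t y = -U.smear (deriv f) x :=
    integral_bilinear_hasDerivAt_right_eq_neg_left_of_integrable
      (L := ContinuousLinearMap.lsmul ℝ ℂ)
      (fun t _ => (hf.differentiable t).hasDerivAt) (fun t _ => hH.hasDerivAt_op h t)
      (hf.integrable_smul ((U.continuous_op y).const_smul _))
      (integrable_smul_op hf.deriv x) (integrable_smul_op hf x)
  simp only [smul_comm (f _), integral_smul] at h_parts
  rw [neg_mul, neg_smul, ← smul_neg, ← h_parts, ← smear, smul_smul]
  have h_scalar : Complex.I * ħ * (-Complex.I / ħ) = 1 := by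
    have : (ħ : ℂ) ≠ 0 := Complex.ofReal_ne_zero.2 hħ
    field_simp
    simp
  rw [h_scalar, one_smul]

variable [CompleteSpace 𝓗]

theorem smear_mem_graph (hH : IsHamiltonian ħ H U) (hħ : ħ ≠ 0) (hf : IsTest f) (x : 𝓗) :
    (U.smear f x, (-Complex.I * ħ) • U.smear (deriv f) x) ∈ H.graph := by
  rw [hH, smul_smul]
  convert hasDerivAt_op_smear hf x 0 using 1
  have h_scalar : -Complex.I / (ħ : ℂ) * (-Complex.I * ħ) = -1 := by
    have : (ħ : ℂ) ≠ 0 := Complex.ofReal_ne_zero.2 hħ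
    field_simp
    exact Complex.I_sq
  rw [h_scalar, neg_one_smul, U.op_zero]

theorem smear_mem_graph_of_mem_graph (hH : IsHamiltonian ħ H U) (hħ : ħ ≠ 0) (hf : IsTest f)
    (h : (x, y) ∈ H.graph) : (U.smear f x, U.smear f y) ∈ H.graph := by
  rw [hH.smear_of_mem_graph hħ hf h]
  exact hH.smear_mem_graph hħ hf x

theorem dense_domain (hH : IsHamiltonian ħ H U) (hħ : ħ ≠ 0) : Dense (H.domain : Set 𝓗) := by
  rw [Submodule.dense_iff_topologicalClosure_eq_top, Submodule.topologicalClosure_eq_top_iff,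
    Submodule.eq_bot_iff]
  intro y hy
  have h_zero : Set.EqOn (fun t => ⟪y, U.op t y⟫_ℂ) 0 Set.univ :=
    eqOn_zero_of_integral_test_mul_eq_zero (continuous_const.inner (U.continuous_op y)) isOpen_univ
      fun f hf _ => by
        rw [← inner_smear hf]
        exact Submodule.inner_left_of_mem_orthogonal
          (H.mem_domain_of_mem_graph (hH.smear_mem_graph hħ hf y)) hy
  simpa [U.op_zero] using h_zero (Set.mem_univ 0)

/-- The nontrivial half of self-adjointness: the adjoint of `H` is contained in `H`. -/
theorem mem_graph_of_forall_inner (hH : IsHamiltonian ħ H U) (hħ : ħ ≠ 0)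
    (h : ∀ u v, (u, v) ∈ H.graph → ⟪v, x⟫_ℂ = ⟪u, y⟫_ℂ) : (x, y) ∈ H.graph := by
  have h_weak : ∀ u ∈ H.domain, ∀ s, HasDerivAt (fun s => ⟪u, U.op s x⟫_ℂ)
      ⟪u, (-Complex.I / ħ) • U.op s y⟫_ℂ s := fun u hu s => by
    have hv := H.mem_graph ⟨u, hu⟩
    have h_deriv := ((hH.hasDerivAt_op hv (-s)).scomp s (hasDerivAt_neg s)).inner ℂ
      (hasDerivAt_const s x)
    have h_fun : (fun s => ⟪U.op (-s) u, x⟫_ℂ) = fun s => ⟪u, U.op s x⟫_ℂ :=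
      funext fun s => U.inner_op_neg_left s u x
    rw [← h_fun]
    refine h_deriv.congr_deriv ?_
    rw [inner_zero_right, zero_add, neg_one_smul, inner_neg_left, inner_smul_left,
      h _ _ (hH.mem_graph (-s) hv), inner_smul_right, U.inner_op_neg_left]
    simp [neg_div]
  have h_cont : Continuous fun s => (-Complex.I / (ħ : ℂ)) • U.op s y :=
    (U.continuous_op y).const_smul _
  rw [hH]
  simpa only [U.op_zero] using hasDerivAt_of_forall_inner (hH.dense_domain hħ) h_cont h_weak 0

theorem isClosed_graph (hH : IsHamiltonian ħ H U) (hħ : ħ ≠ 0) :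
    IsClosed (H.graph : Set (𝓗 × 𝓗)) := by
  have h_eq : (H.graph : Set (𝓗 × 𝓗)) =
      ⋂ p ∈ H.graph, {q | ⟪p.2, q.1⟫_ℂ = ⟪p.1, q.2⟫_ℂ} := by
    ext q
    simp only [SetLike.mem_coe, Set.mem_iInter, Set.mem_ofPred_eq]
    exact ⟨fun hq p hp => hH.inner_symm hħ hp hq,
      fun hq => hH.mem_graph_of_forall_inner hħ fun u v huv => hq (u, v) huv⟩
  rw [h_eq]
  exact isClosed_biInter fun p _ => isClosed_eq (by fun_prop) (by fun_prop)

/-- Since `H² = -ħ² d²/dt²` on profiles, `1 + H²` acts on a smeared vector by applying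
`helmholtz ħ` to its profile. -/
theorem inner_smear_helmholtz (hH : IsHamiltonian ħ H U) (hħ : ħ ≠ 0) (hf : IsTest f)
    (h : (x, x') ∈ H.graph) (h' : (y, y') ∈ H.graph) : ⟪x, U.smear (helmholtz ħ f) y⟫_ℂ =
      ⟪x, U.smear f y⟫_ℂ + ⟪x', U.smear f y'⟫_ℂ := by
  have h_smear : U.smear (helmholtz ħ f) y =
      U.smear f y + (-(ħ : ℂ) ^ 2) • U.smear (deriv (deriv f)) y := by
    rw [← smear_const_smul, ← smear_add hf (hf.deriv.deriv.const_smul _)]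
    congr 1
    ext t
    simp [helmholtz, sub_eq_add_neg]
  rw [hH.smear_of_mem_graph hħ hf h', h_smear, inner_add_right, inner_smul_right,
    inner_smul_right, hH.inner_symm hħ h (hH.smear_mem_graph hħ hf.deriv y), inner_smul_right]
  linear_combination (ħ : ℂ) ^ 2 * ⟪x, U.smear (deriv (deriv f)) y⟫_ℂ * (-Complex.I_sq)

end IsHamiltonian

/-! ### Kets and wave packets -/

namespace Ket

variable {H : 𝓗 →ₗ.[ℂ] 𝓗}

/-- `χ` represents the ket `ψ` by the Riesz theorem for the graph inner product on the domain of
`H`; formally, `ψ = (1 + H²) χ`. -/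
def IsRieszVector (ψ : Ket H) (χ : H.domain) : Prop :=
  ∀ φ : H.domain, ψ.amp φ = ⟪(φ : 𝓗), χ⟫_ℂ + ⟪H φ, H χ⟫_ℂ

theorem exists_isRieszVector [CompleteSpace 𝓗] (ψ : Ket H)
    (h_closed : IsClosed (H.graph : Set (𝓗 × 𝓗))) : ∃ χ, ψ.IsRieszVector χ := by
  obtain ⟨C, hC⟩ := ψ.bounded
  let J : H.domain →ₗ[ℂ] WithLp 2 (𝓗 × 𝓗) :=
    (WithLp.linearEquiv 2 ℂ (𝓗 × 𝓗)).symm.toLinearMap ∘ₗ H.domain.subtype.prod H.toFun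
  have hJ : Function.Injective J := fun φ φ' h => Subtype.ext (congrArg WithLp.fst h)
  have hJ_closed : IsClosed (J.range : Set (WithLp 2 (𝓗 × 𝓗))) := by
    convert h_closed.preimage (WithLp.prod_continuous_ofLp 2 𝓗 𝓗)
    ext p
    simp only [SetLike.mem_coe, LinearMap.mem_range, Set.mem_preimage, LinearPMap.mem_graph_iff]
    exact exists_congr fun φ =>
      ⟨fun h => h ▸ ⟨rfl, rfl⟩, fun h => WithLp.ofLp_injective 2 (Prod.ext h.1 h.2)⟩
  have := hJ_closed.completeSpace_coe
  let e : H.domain ≃ₗ[ℂ] J.range := LinearEquiv.ofInjective J hJ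
  let L : J.range →ₗ[ℂ] ℂ := (starLinearEquiv ℂ).toLinearMap ∘ₛₗ ψ.amp ∘ₗ e.symm.toLinearMap
  have hL : ∀ p, ‖L p‖ ≤ 2 * |C| * ‖p‖ := fun p => by
    obtain ⟨φ, rfl⟩ := e.surjective p
    calc ‖L (e φ)‖ = ‖ψ.amp φ‖ := by simp [L]
      _ ≤ |C| * (‖(φ : 𝓗)‖ + ‖H φ‖) := (hC φ).trans (by gcongr; exact le_abs_self C)
      _ ≤ |C| * (‖e φ‖ + ‖e φ‖) := by
        gcongr
        · exact WithLp.norm_fst_le _ (J φ)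
        · exact WithLp.norm_snd_le _ (J φ)
      _ = 2 * |C| * ‖e φ‖ := by ring
  obtain ⟨q, hq⟩ := (InnerProductSpace.toDual ℂ J.range).surjective (L.mkContinuous _ hL)
  obtain ⟨χ, rfl⟩ := e.surjective q
  refine ⟨χ, fun φ => ?_⟩
  calc ψ.amp φ = starRingEnd ℂ (L (e φ)) := by simp [L]
    _ = starRingEnd ℂ ⟪J χ, J φ⟫_ℂ := congrArg _ (DFunLike.congr_fun hq (e φ)).symm
    _ = ⟪J φ, J χ⟫_ℂ := inner_conj_symm _ _
    _ = ⟪(φ : 𝓗), χ⟫_ℂ + ⟪H φ, H χ⟫_ℂ := WithLp.prod_inner_apply _ _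

theorem evolve_zero_amp {ħ : ℝ} {U : UnitaryGroup 𝓗} (hH : IsHamiltonian ħ H U) (ψ : Ket H)
    (φ : H.domain) : (ψ.evolve hH 0).amp φ = ψ.amp φ :=
  congrArg ψ.amp (Subtype.ext ((congrArg (U.op · (φ : 𝓗)) neg_zero).trans (U.op_zero _)))

namespace IsRieszVector

variable {ψ : Ket H} {χ : H.domain} {ħ : ℝ} {U : UnitaryGroup 𝓗} {f : ℝ → ℂ} {v : 𝓗}

theorem evolve (hχ : ψ.IsRieszVector χ) (hH : IsHamiltonian ħ H U) (t : ℝ) :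
    (ψ.evolve hH t).IsRieszVector ⟨U.op t χ, hH.op_mem t χ⟩ := fun φ => by
  refine (hχ ⟨U.op (-t) φ, hH.op_mem (-t) φ⟩).trans ?_
  rw [hH.apply_op, hH.apply_op, U.inner_op_neg_left, U.inner_op_neg_left]

theorem evolve_amp (hχ : ψ.IsRieszVector χ) (hH : IsHamiltonian ħ H U) (t : ℝ) (φ : H.domain) :
    (ψ.evolve hH t).amp φ = ⟪(φ : 𝓗), U.op t χ⟫_ℂ + ⟪H φ, U.op t (H χ)⟫_ℂ := by
  rw [hχ.evolve hH t φ, hH.apply_op]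

theorem continuous_evolve_amp (hχ : ψ.IsRieszVector χ) (hH : IsHamiltonian ħ H U)
    (φ : H.domain) : Continuous fun t => (ψ.evolve hH t).amp φ := by
  simp only [hχ.evolve_amp hH]
  exact (continuous_const.inner (U.continuous_op χ)).add
    (continuous_const.inner (U.continuous_op (H χ)))

theorem norm_evolve_amp_le (hχ : ψ.IsRieszVector χ) (hH : IsHamiltonian ħ H U) (t : ℝ)
    (φ : H.domain) : ‖(ψ.evolve hH t).amp φ‖ ≤ ‖φ‖ * ‖χ‖ + ‖H φ‖ * ‖H χ‖ := by
  rw [hχ.evolve_amp hH]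
  refine norm_add_le_of_le ((norm_inner_le_norm _ _).trans_eq ?_)
    ((norm_inner_le_norm _ _).trans_eq ?_)
  · rw [LinearIsometryEquiv.norm_map, Submodule.coe_norm, Submodule.coe_norm]
  · rw [LinearIsometryEquiv.norm_map]

theorem evolve_neg_amp_self (hχ : ψ.IsRieszVector χ) (hH : IsHamiltonian ħ H U) (t : ℝ) :
    (ψ.evolve hH (-t)).amp χ = starRingEnd ℂ ((ψ.evolve hH t).amp χ) := by
  simp only [hχ.evolve_amp hH, map_add, inner_conj_symm, ← U.inner_op_neg_left (-t), neg_neg]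

theorem amp_self (hχ : ψ.IsRieszVector χ) : ψ.amp χ = ((‖χ‖ ^ 2 + ‖H χ‖ ^ 2 : ℝ) : ℂ) := by
  rw [hχ χ, inner_self_eq_norm_sq_to_K, inner_self_eq_norm_sq_to_K]
  push_cast
  rfl

theorem ne_zero (hχ : ψ.IsRieszVector χ) (hψ : ψ.amp ≠ 0) : χ ≠ 0 := by
  rintro rfl
  exact hψ (LinearMap.ext fun φ => by simp [hχ φ])

variable [CompleteSpace 𝓗]

theorem integral_mul_evolve_amp (hχ : ψ.IsRieszVector χ) (hH : IsHamiltonian ħ H U)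
    (hf : IsTest f) (φ : H.domain) : ∫ t, f t * (ψ.evolve hH t).amp φ =
      ⟪(φ : 𝓗), U.smear f χ⟫_ℂ + ⟪H φ, U.smear f (H χ)⟫_ℂ := by
  simp only [hχ.evolve_amp hH, mul_add, inner_smear hf]
  exact integral_add (hf.integrable_smul (continuous_const.inner (U.continuous_op χ)))
    (hf.integrable_smul (continuous_const.inner (U.continuous_op (H χ))))

theorem isPacket_smear (hχ : ψ.IsRieszVector χ) (hH : IsHamiltonian ħ H U) (hħ : ħ ≠ 0)
    (hf : IsTest f) : IsPacket hH ψ f (U.smear (helmholtz ħ f) χ) := fun φ => by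
  rw [hχ.integral_mul_evolve_amp hH hf,
    hH.inner_smear_helmholtz hħ hf (H.mem_graph φ) (H.mem_graph χ)]

theorem exists_isPacket (hχ : ψ.IsRieszVector χ) (hH : IsHamiltonian ħ H U) (hħ : ħ ≠ 0)
    (hf : IsTest f) : ∃ v : H.domain, IsPacket hH ψ f v :=
  ⟨⟨_, H.mem_domain_of_mem_graph (hH.smear_mem_graph hħ (hf.helmholtz ħ) χ)⟩,
    hχ.isPacket_smear hH hħ hf⟩

theorem isPacket_iff (hχ : ψ.IsRieszVector χ) (hH : IsHamiltonian ħ H U) (hħ : ħ ≠ 0)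
    (hf : IsTest f) : IsPacket hH ψ f v ↔ v = U.smear (helmholtz ħ f) χ := by
  refine ⟨fun hv => (hH.dense_domain hħ).eq_of_inner_right ℂ fun φ hφ => ?_, fun hv => ?_⟩
  · rw [hv ⟨φ, hφ⟩, hχ.isPacket_smear hH hħ hf ⟨φ, hφ⟩]
  · exact hv ▸ hχ.isPacket_smear hH hħ hf

theorem amp_packet (hχ : ψ.IsRieszVector χ) (hH : IsHamiltonian ħ H U) (hħ : ħ ≠ 0)
    (hf : IsTest f) {v : H.domain} (hv : IsPacket hH ψ f v) :
    ψ.amp v = starRingEnd ℂ (∫ t, helmholtz ħ f t * (ψ.evolve hH t).amp χ) := by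
  have h_v : (v : 𝓗) = U.smear (helmholtz ħ f) χ := (hχ.isPacket_iff hH hħ hf).1 hv
  have h_Hv : H v = U.smear (helmholtz ħ f) (H χ) := H.mem_graph_snd_inj (H.mem_graph v)
    (hH.smear_mem_graph_of_mem_graph hħ (hf.helmholtz ħ) (H.mem_graph χ)) h_v
  rw [hχ.integral_mul_evolve_amp hH (hf.helmholtz ħ), ← h_v, ← h_Hv, map_add, inner_conj_symm,
    inner_conj_symm, hχ v]

end IsRieszVector

end Ket

section Packets

variable {ħ c : ℝ} {H : 𝓗 →ₗ.[ℂ] 𝓗} {U : UnitaryGroup 𝓗} {hH : IsHamiltonian ħ H U} {ψ : Ket H}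
  {f g : ℝ → ℂ} {v w : 𝓗}

theorem IsPacket.op (hv : IsPacket hH ψ f v) (s : ℝ) :
    IsPacket hH ψ (fun t => f (t - s)) (U.op s v) := fun φ => by
  have h_amp : ∀ t, (ψ.evolve hH t).amp ⟨U.op (-s) φ, hH.op_mem (-s) φ⟩ =
      (ψ.evolve hH (t + s)).amp φ := fun t => by
    have h_op : U.op (-t) (U.op (-s) φ) = U.op (-(t + s)) φ := by rw [← U.op_add, neg_add]
    exact congrArg ψ.amp (Subtype.ext h_op)
  calc ⟪(φ : 𝓗), U.op s v⟫_ℂ = ⟪U.op (-s) φ, v⟫_ℂ := (U.inner_op_neg_left _ _ _).symm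
    _ = ∫ t, f t * (ψ.evolve hH t).amp ⟨U.op (-s) φ, hH.op_mem (-s) φ⟩ := hv ⟨_, _⟩
    _ = ∫ t, f (t + s - s) * (ψ.evolve hH (t + s)).amp φ := by
      simp only [h_amp, add_sub_cancel_right]
    _ = ∫ t, f (t - s) * (ψ.evolve hH t).amp φ :=
      integral_add_right_eq_self (fun t => f (t - s) * (ψ.evolve hH t).amp φ) s

/-! ### Delta-correlated kets -/

/-- The states in the history of `ψ` satisfy `⟨ψ(s)|ψ(t)⟩ = c² δ(s - t)`, in the sense of
distributions; by invariance under the evolution only `s = 0` has to be considered. -/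
def IsDeltaCorrelated (hH : IsHamiltonian ħ H U) (ψ : Ket H) (c : ℝ) : Prop :=
  ∀ f, IsTest f → ∀ v : H.domain, IsPacket hH ψ f v → ψ.amp v = c ^ 2 * starRingEnd ℂ (f 0)

/-- One-sided orthogonality says that the autocorrelation `K`, `K t = ⟨χ|ψ(t)⟩`, solves
`K - ħ² K'' = 0` on a half-line, so it is a multiple of the fundamental solution `exp (-|t|/ħ)`. -/
theorem Ket.IsRieszVector.exists_isDeltaCorrelated [CompleteSpace 𝓗] {χ : H.domain}
    (hχ : ψ.IsRieszVector χ) (hħ : 0 < ħ) (hψ : ψ.amp ≠ 0)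
    (horth : IsOrthogonalOn hH ψ 0 (Set.Iio 0) ∨ IsOrthogonalOn hH ψ 0 (Set.Ioi 0)) :
    ∃ c : ℝ, 0 < c ∧ IsDeltaCorrelated hH ψ c := by
  obtain ⟨J, hJ, hJ_orth⟩ : ∃ J, (J = Set.Iio 0 ∨ J = Set.Ioi 0) ∧ IsOrthogonalOn hH ψ 0 J :=
    horth.elim (fun h => ⟨_, .inl rfl, h⟩) fun h => ⟨_, .inr rfl, h⟩
  have hK_orth : ∀ f, IsTest f → tsupport f ⊆ J →
      ∫ t, helmholtz ħ f t * (ψ.evolve hH t).amp χ = 0 := fun f hf hfJ => by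
    obtain ⟨v, hv⟩ := hχ.exists_isPacket hH hħ.ne' hf
    have h_amp := hJ_orth f hf hfJ v hv
    rwa [ψ.evolve_zero_amp hH, hχ.amp_packet hH hħ.ne' hf hv, map_eq_zero] at h_amp
  have hK : ∀ t, (ψ.evolve hH t).amp χ =
      Real.exp (-|t| / ħ) * ((‖χ‖ ^ 2 + ‖H χ‖ ^ 2 : ℝ) : ℂ) := by
    rw [← hχ.amp_self, ← ψ.evolve_zero_amp hH]
    exact eq_exp_neg_abs_mul_of_integral_helmholtz_mul_eq_zero hħ (hχ.continuous_evolve_amp hH χ)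
      (hχ.norm_evolve_amp_le hH · χ) (hχ.evolve_neg_amp_self hH) hJ hK_orth
  have h_pos : 0 < ‖χ‖ ^ 2 + ‖H χ‖ ^ 2 := by
    have := norm_pos_iff.2 (hχ.ne_zero hψ)
    positivity
  refine ⟨√(2 * ħ * (‖χ‖ ^ 2 + ‖H χ‖ ^ 2)), by positivity, fun f hf v hv => ?_⟩
  simp only [hχ.amp_packet hH hħ.ne' hf hv, hK, ← mul_assoc, integral_mul_const,
    integral_helmholtz_mul_exp_neg_abs hħ.ne' hf]
  rw [← Complex.ofReal_pow, Real.sq_sqrt (by positivity)]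
  simp only [map_mul, Complex.conj_ofReal, map_ofNat, Complex.ofReal_mul, Complex.ofReal_ofNat]
  ring

namespace IsDeltaCorrelated

theorem evolve_amp (h : IsDeltaCorrelated hH ψ c) (hf : IsTest f) {v : H.domain}
    (hv : IsPacket hH ψ f v) (s : ℝ) :
    (ψ.evolve hH s).amp v = c ^ 2 * starRingEnd ℂ (f s) := by
  have h_shift := h _ (hf.comp_sub_right (-s)) ⟨U.op (-s) v, hH.op_mem (-s) v⟩ (hv.op (-s))
  rwa [sub_neg_eq_add, zero_add] at h_shift

theorem isOrthogonalOn (h : IsDeltaCorrelated hH ψ c) (s : ℝ) : IsOrthogonalOn hH ψ s {s}ᶜ :=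
  fun f hf hfs v hv => by
    rw [h.evolve_amp hf hv, image_eq_zero_of_notMem_tsupport fun hs => hfs hs rfl, map_zero,
      mul_zero]

theorem inner_packet (h : IsDeltaCorrelated hH ψ c) (hf : IsTest f) {v : H.domain}
    (hv : IsPacket hH ψ f v) (hw : IsPacket hH ψ g w) :
    ⟪(v : 𝓗), w⟫_ℂ = c ^ 2 * ∫ t, starRingEnd ℂ (f t) * g t := by
  rw [hw v, ← integral_const_mul]
  exact integral_congr_ae (.of_forall fun t => by simp only [h.evolve_amp hf hv]; ring)

end IsDeltaCorrelated

/-! ### The space spanned by the history -/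

theorem op_mem_historySpan (hH : IsHamiltonian ħ H U) (ψ : Ket H) (t : ℝ) (x : 𝓗)
    (hx : x ∈ historySpan hH ψ) : U.op t x ∈ historySpan hH ψ := by
  have h_le : historySpan hH ψ ≤
      (historySpan hH ψ).comap (U.op t).toLinearEquiv.toLinearMap := by
    refine Submodule.topologicalClosure_minimal _ (Submodule.span_le.2 ?_)
      ((Submodule.isClosed_topologicalClosure _).preimage (U.op t).continuous)
    rintro v ⟨f, hf, hv⟩
    exact Submodule.le_topologicalClosure _
      (Submodule.subset_span ⟨_, hf.comp_sub_right t, hv.op t⟩)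
  exact h_le hx

/-! ### Translations of `L²(ℝ)` -/

/-- The space of test functions, on which wave packets depend linearly. -/
def testSpace : Submodule ℂ (ℝ → ℂ) where
  carrier := {f | IsTest f}
  add_mem' hf hg := hf.add hg
  zero_mem' := ⟨contDiff_const, HasCompactSupport.zero⟩
  smul_mem' c _ hf := hf.const_smul c

theorem IsTest.memLp {f : ℝ → ℂ} (hf : IsTest f) : MemLp f 2 (volume : Measure ℝ) :=
  hf.continuous.memLp_of_hasCompactSupport hf.2

/-- The inclusion of the test functions in `L²(ℝ)`. -/
def testToLp : testSpace →ₗ[ℂ] Lp ℂ 2 (volume : Measure ℝ) where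
  toFun f := (IsTest.memLp f.2).toLp f.1
  map_add' _ _ := rfl
  map_smul' _ _ := rfl

theorem coeFn_testToLp (f : testSpace) : testToLp f =ᵐ[volume] f.1 :=
  MemLp.coeFn_toLp (IsTest.memLp f.2)

theorem denseRange_testToLp : DenseRange testToLp := by
  refine (Lp.dense_hasCompactSupport_contDiff (μ := (volume : Measure ℝ)) (F := ℂ)
    (p := 2) (by simp)).mono ?_
  rintro u ⟨g, hg, hg_supp, hg_smooth⟩
  exact ⟨⟨g, hg_smooth, hg_supp⟩, Lp.ext ((coeFn_testToLp _).trans hg.symm)⟩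

theorem inner_testToLp (f : testSpace) (g : Lp ℂ 2 (volume : Measure ℝ)) :
    ⟪testToLp f, g⟫_ℂ = ∫ t, starRingEnd ℂ (f.1 t) * g t := by
  rw [L2.inner_def]
  refine integral_congr_ae ?_
  filter_upwards [coeFn_testToLp f] with t ht
  rw [RCLike.inner_apply, ht, mul_comm]

/-- Differentiation of test functions. -/
def testDeriv (f : testSpace) : testSpace := ⟨deriv f.1, IsTest.deriv f.2⟩

/-- Translation of test functions, taking `f` to `f (· - t)`. -/
def testTranslate (t : ℝ) (f : testSpace) : testSpace :=
  ⟨fun τ => f.1 (τ - t), IsTest.comp_sub_right f.2 t⟩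

/-- Translation by `t` on `L²(ℝ)`, taking `g` to `g (· - t)`. -/
def translate (t : ℝ) : Lp ℂ 2 (volume : Measure ℝ) →ₗᵢ[ℂ] Lp ℂ 2 (volume : Measure ℝ) :=
  Lp.compMeasurePreservingₗᵢ ℂ (· - t) (measurePreserving_sub_right volume t)

theorem coeFn_translate (t : ℝ) (g : Lp ℂ 2 (volume : Measure ℝ)) :
    translate t g =ᵐ[volume] fun τ => g (τ - t) :=
  Lp.coeFn_compMeasurePreserving g (measurePreserving_sub_right volume t)

theorem translate_eq_of_ae_eq {t : ℝ} {g h : Lp ℂ 2 (volume : Measure ℝ)} {k : ℝ → ℂ}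
    (hg : g =ᵐ[volume] k) (hh : h =ᵐ[volume] fun τ => k (τ - t)) : translate t g = h :=
  Lp.ext <| (coeFn_translate t g).trans <|
    ((measurePreserving_sub_right volume t).quasiMeasurePreserving.ae_eq_comp hg).trans hh.symm

theorem translate_add (s t : ℝ) (g : Lp ℂ 2 (volume : Measure ℝ)) :
    translate (s + t) g = translate s (translate t g) := by
  refine (translate_eq_of_ae_eq (coeFn_translate t g) ((coeFn_translate _ g).trans ?_)).symm
  simp only [sub_sub, Filter.EventuallyEq.rfl]

theorem translate_zero (g : Lp ℂ 2 (volume : Measure ℝ)) : translate 0 g = g :=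
  translate_eq_of_ae_eq .rfl (by simp only [sub_zero, Filter.EventuallyEq.rfl])

/-- The unitary group of the translations of `L²(ℝ)`. -/
def translation : UnitaryGroup (Lp ℂ 2 (volume : Measure ℝ)) where
  op t := LinearIsometryEquiv.ofSurjective (translate t) fun g =>
    ⟨translate (-t) g, by rw [← translate_add, add_neg_cancel, translate_zero]⟩
  op_add := translate_add
  continuous_op g := continuous_const.compMeasurePreservingLp
    (f := fun _ : ℝ => g) (g := fun t => ⟨(· - t), by fun_prop⟩)
    (ContinuousMap.continuous_of_continuous_uncurry _ (continuous_snd.sub continuous_fst))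
    (measurePreserving_sub_right volume) (by simp)

theorem coeFn_translation (t : ℝ) (g : Lp ℂ 2 (volume : Measure ℝ)) :
    translation.op t g =ᵐ[volume] fun τ => g (τ - t) :=
  coeFn_translate t g

theorem translation_testToLp (t : ℝ) (f : testSpace) :
    translation.op t (testToLp f) = testToLp (testTranslate t f) :=
  translate_eq_of_ae_eq (coeFn_testToLp f) (coeFn_testToLp _)

theorem testDeriv_testTranslate (t : ℝ) (f : testSpace) :
    testDeriv (testTranslate t f) = testTranslate t (testDeriv f) :=
  Subtype.ext (funext fun τ => deriv_comp_sub_const f.1 t τ)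

theorem deriv_conj (f : ℝ → ℂ) :
    deriv (fun t => starRingEnd ℂ (f t)) = fun t => starRingEnd ℂ (deriv f t) :=
  funext fun _ => deriv.star

theorem hasWeakDeriv_iff_inner {g g' : Lp ℂ 2 (volume : Measure ℝ)} : HasWeakDeriv g g' ↔
    ∀ f : testSpace, ⟪testToLp (testDeriv f), g⟫_ℂ = -⟪testToLp f, g'⟫_ℂ := by
  simp only [inner_testToLp, testDeriv]
  refine ⟨fun h f => by simpa only [deriv_conj] using h _ (IsTest.conj f.2), fun h φ hφ => ?_⟩
  simpa only [deriv_conj, Complex.conj_conj] using h ⟨_, hφ.conj⟩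

theorem hasDerivAt_inner_translation (f : testSpace) (g : Lp ℂ 2 (volume : Measure ℝ)) (t : ℝ) :
    HasDerivAt (fun t => ⟪testToLp f, translation.op t g⟫_ℂ)
      ⟪testToLp (testDeriv f), translation.op t g⟫_ℂ t := by
  have hg : LocallyIntegrable g volume := (Lp.memLp g).locallyIntegrable (by simp)
  have h_deriv := (IsTest.hasDerivAt_integral_comp_sub_smul (IsTest.conj f.2) hg (-t)).scomp t
    (hasDerivAt_neg t)
  simp only [← translation.inner_op_neg_left, translation_testToLp, inner_testToLp]
  refine h_deriv.congr_deriv ?_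
  rw [neg_one_smul, neg_neg, deriv_conj]
  rfl

theorem hasDerivAt_translation_iff {g g' : Lp ℂ 2 (volume : Measure ℝ)} :
    HasDerivAt (fun t => translation.op t g) (-g') 0 ↔ HasWeakDeriv g g' := by
  rw [hasWeakDeriv_iff_inner]
  refine ⟨fun h f => ?_, fun h => ?_⟩
  · have h_deriv := (hasDerivAt_const 0 (testToLp f)).inner ℂ h
    have h_unique := (hasDerivAt_inner_translation f g 0).unique h_deriv
    simpa [translation.op_zero] using h_unique
  · have h_weak : ∀ v ∈ Set.range testToLp, ∀ s, HasDerivAt (fun s => ⟪v, translation.op s g⟫_ℂ)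
        ⟪v, -translation.op s g'⟫_ℂ s := by
      rintro _ ⟨f, rfl⟩ s
      refine (hasDerivAt_inner_translation f g s).congr_deriv ?_
      rw [inner_neg_right, ← translation.inner_op_neg_left, ← translation.inner_op_neg_left,
        translation_testToLp, translation_testToLp, ← testDeriv_testTranslate, h]
    have h_cont : Continuous fun s => -translation.op s g' := (translation.continuous_op g').neg
    have h_deriv := hasDerivAt_of_forall_inner denseRange_testToLp h_cont h_weak 0
    rw [translation.op_zero] at h_deriv
    exact h_deriv

/-! ### The time representation -/

instance (hH : IsHamiltonian ħ H U) (ψ : Ket H) [CompleteSpace 𝓗] :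
    CompleteSpace (historySpan hH ψ) :=
  (Submodule.isClosed_topologicalClosure _).completeSpace_coe

namespace Ket.IsRieszVector

variable [CompleteSpace 𝓗] {χ : H.domain}

/-- The map that takes a test function to the wave packet with this profile. -/
def packetMap (hχ : ψ.IsRieszVector χ) (hH : IsHamiltonian ħ H U) (hħ : ħ ≠ 0) :
    testSpace →ₗ[ℂ] historySpan hH ψ where
  toFun f := ⟨U.smear (helmholtz ħ f.1) χ, Submodule.le_topologicalClosure _
    (Submodule.subset_span ⟨f.1, f.2, hχ.isPacket_smear hH hħ f.2⟩)⟩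
  map_add' f g := Subtype.ext <| by
    simp only [Submodule.coe_add, helmholtz_add ħ f.2 g.2]
    exact smear_add (IsTest.helmholtz f.2 ħ) (IsTest.helmholtz g.2 ħ) (χ : 𝓗)
  map_smul' a f := Subtype.ext <| by
    simp only [SetLike.val_smul, helmholtz_const_smul, smear_const_smul, RingHom.id_apply]

theorem isPacket_iff_eq_packetMap (hχ : ψ.IsRieszVector χ) (hħ : ħ ≠ 0) {f : testSpace}
    {v : historySpan hH ψ} : IsPacket hH ψ f.1 (v : 𝓗) ↔ v = hχ.packetMap hH hħ f := by
  rw [hχ.isPacket_iff hH hħ f.2, Subtype.ext_iff]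
  rfl

theorem denseRange_packetMap (hχ : ψ.IsRieszVector χ) (hH : IsHamiltonian ħ H U) (hħ : ħ ≠ 0) :
    DenseRange (hχ.packetMap hH hħ) := by
  have h_span : Submodule.span ℂ {v | ∃ f, IsTest f ∧ IsPacket hH ψ f v} ≤
      ((hχ.packetMap hH hħ).range).map (historySpan hH ψ).subtype := by
    refine Submodule.span_le.2 ?_
    rintro v ⟨f, hf, hv⟩
    exact ⟨_, ⟨⟨f, hf⟩, rfl⟩, ((hχ.isPacket_iff hH hħ hf).1 hv).symm⟩
  exact Topology.IsInducing.subtypeVal.dense_iff.2 fun x => closure_mono h_span x.2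

theorem norm_packetMap (hχ : ψ.IsRieszVector χ) (hħ : ħ ≠ 0) (h : IsDeltaCorrelated hH ψ c)
    (f : testSpace) : ‖hχ.packetMap hH hħ f‖ = ‖(c : ℂ) • testToLp f‖ := by
  set v := hχ.packetMap hH hħ f
  have hv : IsPacket hH ψ f.1 (v : 𝓗) := hχ.isPacket_smear hH hħ f.2
  have hv_mem : (v : 𝓗) ∈ H.domain :=
    H.mem_domain_of_mem_graph (hH.smear_mem_graph hħ (IsTest.helmholtz f.2 ħ) χ)
  have h_inner : ⟪testToLp f, testToLp f⟫_ℂ = ∫ t, starRingEnd ℂ (f.1 t) * f.1 t := by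
    rw [inner_testToLp]
    refine integral_congr_ae ?_
    filter_upwards [coeFn_testToLp f] with t ht
    rw [ht]
  have h_sq : ((‖v‖ ^ 2 : ℝ) : ℂ) = ((‖(c : ℂ) • testToLp f‖ ^ 2 : ℝ) : ℂ) := by
    calc ((‖v‖ ^ 2 : ℝ) : ℂ) = ⟪(v : 𝓗), v⟫_ℂ := by
          rw [inner_self_eq_norm_sq_to_K, Submodule.coe_norm]
          norm_cast
      _ = c ^ 2 * ⟪testToLp f, testToLp f⟫_ℂ := by
          rw [h_inner, ← h.inner_packet f.2 (v := ⟨v, hv_mem⟩) hv hv]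
      _ = ((‖(c : ℂ) • testToLp f‖ ^ 2 : ℝ) : ℂ) := by
          rw [inner_self_eq_norm_sq_to_K, norm_smul, mul_pow, Complex.norm_real,
            Real.norm_eq_abs, sq_abs]
          push_cast
          rfl
  exact (pow_left_inj₀ (norm_nonneg _) (norm_nonneg _) two_ne_zero).1
    (Complex.ofReal_injective h_sq)

end Ket.IsRieszVector

/-- `W` represents the states in the history of `ψ` on `L²(ℝ)` by `c` times the Dirac kets: it
identifies the packet with profile `f` with `c f`. The equivalence includes existence and
uniqueness of the packet. -/
def IsTimeRepresentation (hH : IsHamiltonian ħ H U) (ψ : Ket H) (c : ℝ)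
    (W : historySpan hH ψ ≃ₗᵢ[ℂ] Lp ℂ 2 (volume : Measure ℝ)) : Prop :=
  ∀ (f : testSpace) (v : historySpan hH ψ),
    IsPacket hH ψ f.1 (v : 𝓗) ↔ W v = (c : ℂ) • testToLp f

theorem denseRange_const_smul_testToLp (hc : c ≠ 0) : DenseRange ((c : ℂ) • testToLp) :=
  (Homeomorph.smulOfNeZero (c : ℂ) (Complex.ofReal_ne_zero.2 hc)).surjective.denseRange.comp
    denseRange_testToLp (Homeomorph.continuous _)

theorem Ket.IsRieszVector.exists_isTimeRepresentation [CompleteSpace 𝓗] {χ : H.domain}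
    (hχ : ψ.IsRieszVector χ) (hħ : ħ ≠ 0) (hc : c ≠ 0) (h : IsDeltaCorrelated hH ψ c) :
    ∃ W, IsTimeRepresentation hH ψ c W := by
  have h_norm : ∀ f, ‖((c : ℂ) • testToLp) (LinearEquiv.refl ℂ testSpace f)‖ =
      ‖hχ.packetMap hH hħ f‖ := fun f => (hχ.norm_packetMap hħ h f).symm
  let W := (LinearEquiv.refl ℂ testSpace).extendOfIsometry (hχ.packetMap hH hħ)
    ((c : ℂ) • testToLp) (hχ.denseRange_packetMap hH hħ) (denseRange_const_smul_testToLp hc) h_norm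
  have hW : ∀ f, W (hχ.packetMap hH hħ f) = (c : ℂ) • testToLp f :=
    LinearEquiv.extendOfIsometry_eq _ _ _ _ _ h_norm
  exact ⟨W, fun f v => by rw [hχ.isPacket_iff_eq_packetMap hħ, ← hW, W.injective.eq_iff]⟩

theorem hasDerivAt_linearIsometry_comp_iff {E F : Type*} [NormedAddCommGroup E]
    [InnerProductSpace ℂ E] [NormedAddCommGroup F] [InnerProductSpace ℂ F] (J : E →ₗᵢ[ℂ] F)
    {k : ℝ → E} {k' : E} {t : ℝ} :
    HasDerivAt (fun t => J (k t)) (J k') t ↔ HasDerivAt k k' t := by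
  simp only [hasDerivAt_iff_tendsto, ← map_real_smul J J.continuous, ← map_sub, J.norm_map]

namespace IsTimeRepresentation

variable {W : historySpan hH ψ ≃ₗᵢ[ℂ] Lp ℂ 2 (volume : Measure ℝ)}

theorem coeFn_packet (hW : IsTimeRepresentation hH ψ c W) (hf : IsTest f) {v : historySpan hH ψ}
    (hv : IsPacket hH ψ f (v : 𝓗)) : W v =ᵐ[volume] fun τ => (c : ℂ) * f τ := by
  rw [(hW ⟨f, hf⟩ v).1 hv]
  filter_upwards [Lp.coeFn_smul (c : ℂ) (testToLp ⟨f, hf⟩), coeFn_testToLp ⟨f, hf⟩] with τ h h'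
  rw [h, Pi.smul_apply, h', smul_eq_mul]

theorem op_symm_apply (hW : IsTimeRepresentation hH ψ c W) (hc : c ≠ 0) (t : ℝ)
    (g : Lp ℂ 2 (volume : Measure ℝ)) :
    U.op t (W.symm g : 𝓗) = W.symm (translation.op t g) := by
  have h_left : Continuous fun g => U.op t (W.symm g : 𝓗) := by fun_prop
  have h_right : Continuous fun g => (W.symm (translation.op t g) : 𝓗) := by fun_prop
  refine congrFun ((denseRange_const_smul_testToLp hc).equalizer h_left h_right ?_) g
  ext f
  have h_packet := ((hW f (W.symm ((c : ℂ) • testToLp f))).2 (W.apply_symm_apply _)).op t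
  have h_eq := (hW (testTranslate t f) ⟨_, op_mem_historySpan hH ψ t _ (W.symm _).2⟩).1 h_packet
  rw [← translation_testToLp, ← map_smul, ← W.eq_symm_apply] at h_eq
  exact congrArg Subtype.val h_eq

theorem map_op (hW : IsTimeRepresentation hH ψ c W) (hc : c ≠ 0) (t : ℝ)
    (x : historySpan hH ψ) :
    W ⟨U.op t x, op_mem_historySpan hH ψ t x x.2⟩ = translation.op t (W x) := by
  rw [← W.eq_symm_apply]
  refine Subtype.ext ?_
  rw [← hW.op_symm_apply hc, W.symm_apply_apply]

theorem mem_graph_iff (hW : IsTimeRepresentation hH ψ c W) (hc : c ≠ 0) (hħ : ħ ≠ 0)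
    (x y : historySpan hH ψ) : ((x : 𝓗), (y : 𝓗)) ∈ H.graph ↔
      ∃ g', HasWeakDeriv (W x) g' ∧ W y = (-Complex.I * ħ) • g' := by
  have hħ' : (ħ : ℂ) ≠ 0 := Complex.ofReal_ne_zero.2 hħ
  let J := (historySpan hH ψ).subtypeₗᵢ.comp W.symm.toLinearIsometry
  have hJ : ∀ x, J (W x) = (x : 𝓗) := fun x => congrArg Subtype.val (W.symm_apply_apply x)
  have h_weak : ((x : 𝓗), (y : 𝓗)) ∈ H.graph ↔ HasWeakDeriv (W x) ((Complex.I / ħ) • W y) := by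
    have h_orbit : (fun t => U.op t (x : 𝓗)) = fun t => J (translation.op t (W x)) :=
      funext fun t => by rw [← hJ x]; exact hW.op_symm_apply hc t (W x)
    rw [hH, h_orbit, ← hJ y, ← map_smul, hasDerivAt_linearIsometry_comp_iff, neg_div, neg_smul]
    exact hasDerivAt_translation_iff
  rw [h_weak]
  refine ⟨fun h => ⟨_, h, ?_⟩, ?_⟩
  · rw [smul_smul]
    have : -Complex.I * ħ * (Complex.I / ħ) = 1 := by field_simp; simp
    rw [this, one_smul]
  · rintro ⟨g', hg', h_eq⟩
    have : Complex.I / ħ * (-Complex.I * ħ) = 1 := by field_simp; simp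
    rwa [h_eq, smul_smul, this, one_smul]

end IsTimeRepresentation

end Packets

end QuantumHistory

end

open QuantumHistory in
theorem theorem1 {𝓗 : Type*} [NormedAddCommGroup 𝓗] [InnerProductSpace ℂ 𝓗] [CompleteSpace 𝓗]
    (ħ : ℝ) (hħ : 0 < ħ) (H : 𝓗 →ₗ.[ℂ] 𝓗) (U : UnitaryGroup 𝓗) (hH : IsHamiltonian ħ H U)
    (ψ : Ket H) (hψ : ψ.amp ≠ 0)
    (horth : IsOrthogonalOn hH ψ 0 (Set.Iio 0) ∨ IsOrthogonalOn hH ψ 0 (Set.Ioi 0)) :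
    -- the superpositions of states in the history exist (in the domain of the Hamiltonian)
    (∀ f : ℝ → ℂ, IsTest f → ∃ v : H.domain, IsPacket hH ψ f (v : 𝓗)) ∧
    -- the states at distinct times are orthogonal
    (∀ s : ℝ, IsOrthogonalOn hH ψ s {s}ᶜ) ∧
    -- the spanned space is invariant under the evolution and the Hamiltonian
    ∃ hU : ∀ (t : ℝ) (x : 𝓗), x ∈ historySpan hH ψ → U.op t x ∈ historySpan hH ψ,
    (∀ x : H.domain, (x : 𝓗) ∈ historySpan hH ψ → H x ∈ historySpan hH ψ) ∧
    -- it is identified with `L²(ℝ)`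
    ∃ W : historySpan hH ψ ≃ₗᵢ[ℂ] Lp ℂ 2 (volume : Measure ℝ),
      -- `|ψ(t)⟩` corresponds to a multiple of the Dirac ket `|τ = t⟩`
      (∃ c : ℝ, 0 < c ∧ ∀ f : ℝ → ℂ, IsTest f → ∀ v : historySpan hH ψ,
        IsPacket hH ψ f (v : 𝓗) → (W v : ℝ → ℂ) =ᵐ[volume] fun τ => (c : ℂ) * f τ) ∧
      -- the evolution acts as translation
      (∀ (t : ℝ) (x : historySpan hH ψ),
        (W ⟨U.op t (x : 𝓗), hU t x x.2⟩ : ℝ → ℂ) =ᵐ[volume] fun τ => W x (τ - t)) ∧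
      -- the restricted Hamiltonian is `-iħ d/dτ`, with domain the Sobolev space `H¹(ℝ)`
      (∀ x y : historySpan hH ψ, ((x : 𝓗), (y : 𝓗)) ∈ H.graph ↔
        ∃ g' : Lp ℂ 2 (volume : Measure ℝ),
          HasWeakDeriv (W x) g' ∧ W y = (-Complex.I * (ħ : ℂ)) • g') := by
  obtain ⟨χ, hχ⟩ := ψ.exists_isRieszVector (hH.isClosed_graph hħ.ne')
  obtain ⟨c, hc, h_delta⟩ := hχ.exists_isDeltaCorrelated hħ hψ horth
  obtain ⟨W, hW⟩ := hχ.exists_isTimeRepresentation hħ.ne' hc.ne' h_delta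
  have hU := op_mem_historySpan hH ψ
  refine ⟨fun f hf => hχ.exists_isPacket hH hħ.ne' hf, h_delta.isOrthogonalOn, hU, ?_, W,
    ⟨c, hc, fun f hf v hv => hW.coeFn_packet hf hv⟩, fun t x => ?_,
    hW.mem_graph_iff hc.ne' hħ.ne'⟩
  · exact fun x hx => hH.mem_of_forall_op_mem hħ.ne' (Submodule.isClosed_topologicalClosure _) hU
      (H.mem_graph x) hx
  · rw [hW.map_op hc.ne']
    exact coeFn_translation t (W x)
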